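/- All Hilbert spaces are complex and finite dimensional, alphabets are non-empty finite sets, $\mathbb C^{\mathcal X}$ has the computational basis $\{|x\rangle : x\in\mathcal X\}$, $\mathcal L(\mathsf H)$ denotes the linear operators on $\mathsf H$, a channel is a completely positive trace-preserving linear map, and $\|L\|_1=\operatorname{Tr}\sqrt{L^\dagger L}$. An element $x$ of an alphabet $\mathcal X$ is identified with the operator $|x\rangle\langle x|$ on $\mathbb C^{\mathcal X}$. An augmented quantum encryption of classical messages (AQECM) scheme is a triple $(K,E,D)$ of channels $$K:\mathcal L(\mathbb C)\to\mathcal L(\mathsf K),\qquad E:\mathcal L(\mathsf K\otimes\mathsf M)\to\mathcal L(\mathsf C),\qquad D:\mathcal L(\mathsf K\otimes\mathsf C)\to\mathcal L(\mathsf M\otimes\mathsf F),$$ where $\mathsf K=\mathbb C^{\mathcal K}$ and $\mathsf M=\mathbb C^{\mathcal M}$ for alphabets $\mathcal K$ (keys) and $\mathcal M$ (messages), $\mathsf F=\mathbb C^{\{0,1\}}$, and $\mathsf C$ is a Hilbert space. For $k\in\mathcal K$ put $E_k(\rho)=E(k\otimes\rho)$, $D_k(\rho)=D(k\otimes\rho)$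 and $\overline D_k(\rho)=(I_{\mathsf M}\otimes\langle 1|)\,D_k(\rho)\,(I_{\mathsf M}\otimes|1\rangle)$. Write $k\gets K$ for the random key with $\Pr[k]=\langle k|K(1)|k\rangle$. For $\epsilon,\delta\in\mathbb R$, the scheme is - $\epsilon$-correct if $\mathbb E_{k\gets K}\,\langle m|\,\overline D_k(E_k(m))\,|m\rangle\ge 1-\epsilon$ for all $m\in\mathcal M$; - $\delta$-tamper-evident if for all $m,m'\in\mathcal M$, all Hilbert spaces $\mathsf A$ and all channels $A:\mathcal L(\mathsf C)\to\mathcal L(\mathsf C\otimes\mathsf A)$, $$\Pr_{k\gets K}\Big[\tfrac12\big\|\big((\operatorname{Tr}_{\mathsf M}\circ\overline D_k)\otimes\mathrm{Id}_{\mathsf A}\big)\circ A\circ E_k(m-m')\big\|_1\le\delta\Big]\ge 1-\delta;$$ - $\delta$-encrypting if $\tfrac12\big\|\mathbb E_{k\gets K}E_k(m_0-m_1)\big\|_1\le\delta$ for all $m_0,m_1\in\mathcal M$. **Theorem.** Let $\epsilon,\delta\in\mathbb R$. Every $\epsilon$-correct, $\delta$-tamper-evident AQECM scheme is $\sqrt{19\,(\delta+\sqrt{2\epsilon})}$-encrypting.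 -/

import Mathlib

open scoped Kronecker MatrixOrder ComplexOrder

noncomputable section

namespace TamperEvidence

/-- Operators on the Hilbert space `ℂ^X` with computational basis `X`, as matrices in that basis.
Every finite-dimensional Hilbert space is of this form after a choice of orthonormal basis, and
`ℂ^X ⊗ ℂ^Y` is `ℂ^(X × Y)`. -/
abbrev Op (X : Type*) : Type _ := Matrix X X ℂ

/-- The Schatten 1-norm `Tr √(A† A)`. -/
def traceNorm {X : Type*} [Fintype X] [DecidableEq X] (A : Op X) : ℝ :=
  (Matrix.trace (CFC.sqrt (A.conjTranspose * A))).re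

/-- The map `Φ ⊗ Id_Z`: the linear map sending `L ⊗ N` to `Φ(L) ⊗ N`. -/
def tensorId {X Y : Type*} (Φ : Op X →ₗ[ℂ] Op Y) (Z : Type*) :
    Op (X × Z) →ₗ[ℂ] Op (Y × Z) where
  toFun M := Matrix.of fun p q => Φ (M.submatrix (fun x => (x, p.2)) (fun x => (x, q.2))) p.1 q.1
  map_add' M N := by
    ext p q
    simp [Matrix.submatrix_add]
  map_smul' c M := by
    ext p q
    simp [Matrix.submatrix_smul]

/-- The map `Tr_X ⊗ Id_Z`. -/
def traceFirst {X Z : Type*} [Fintype X] (M : Op (X × Z)) : Op Z :=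
  Matrix.of fun z z' => ∑ x, M (x, z) (x, z')

/-- A (quantum) channel: a completely positive, trace-preserving linear map. -/
structure IsChannel {X Y : Type*} [Fintype X] [Fintype Y] (Φ : Op X →ₗ[ℂ] Op Y) : Prop where
  completely_positive : ∀ (Z : Type) [Fintype Z] (M : Op (X × Z)),
    M.PosSemidef → (tensorId Φ Z M).PosSemidef
  trace_preserving : ∀ L : Op X, (Φ L).trace = L.trace

/-- The projector `|x⟩⟨x|` on a computational basis vector. -/
def basisState {X : Type*} [DecidableEq X] (x : X) : Op X := Matrix.single x x 1

/-- An augmented quantum encryption of classical messages scheme with key alphabet `𝒦`, message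
alphabet `ℳ` and ciphertext space `ℂ^𝒞`. The flag qubit is `ℂ^Bool`, with `true` for "accept". -/
structure AQECM (𝒦 ℳ 𝒞 : Type*) [Fintype 𝒦] [Fintype ℳ] [Fintype 𝒞] where
  keyGen : Op Unit →ₗ[ℂ] Op 𝒦
  enc : Op (𝒦 × ℳ) →ₗ[ℂ] Op 𝒞
  dec : Op (𝒦 × 𝒞) →ₗ[ℂ] Op (ℳ × Bool)
  keyGen_channel : IsChannel keyGen
  enc_channel : IsChannel enc
  dec_channel : IsChannel dec

namespace AQECM

variable {𝒦 ℳ 𝒞 : Type*} [Fintype 𝒦] [Fintype ℳ] [Fintype 𝒞]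

/-- The probability of `k` when the state output by key generation on the empty input is measured
in the computational basis. -/
def keyProb (S : AQECM 𝒦 ℳ 𝒞) (k : 𝒦) : ℝ := (S.keyGen 1 k k).re

/-- The probability over a generated key that the key satisfies `P`. -/
def probKey (S : AQECM 𝒦 ℳ 𝒞) (P : 𝒦 → Prop) : ℝ :=
  ∑ k, Set.indicator {k | P k} S.keyProb k

/-- The encoding map `E_k : ρ ↦ E(|k⟩⟨k| ⊗ ρ)`. -/
def encKey [DecidableEq 𝒦] (S : AQECM 𝒦 ℳ 𝒞) (k : 𝒦) : Op ℳ →ₗ[ℂ] Op 𝒞 :=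
  S.enc ∘ₗ Matrix.kroneckerBilinear (R := ℂ) (basisState k)

/-- The decoding map `D_k : ρ ↦ D(|k⟩⟨k| ⊗ ρ)`. -/
def decKey [DecidableEq 𝒦] (S : AQECM 𝒦 ℳ 𝒞) (k : 𝒦) : Op 𝒞 →ₗ[ℂ] Op (ℳ × Bool) :=
  S.dec ∘ₗ Matrix.kroneckerBilinear (R := ℂ) (basisState k)

/-- The map `ρ ↦ (I ⊗ ⟨1|) D_k(ρ) (I ⊗ |1⟩)`: decode with key `k` and reduce to acceptance. -/
def decAccept [DecidableEq 𝒦] (S : AQECM 𝒦 ℳ 𝒞) (k : 𝒦) : Op 𝒞 →ₗ[ℂ] Op ℳ where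
  toFun ρ := (S.decKey k ρ).submatrix (fun m => (m, true)) (fun m => (m, true))
  map_add' ρ σ := by simp [Matrix.submatrix_add]
  map_smul' c ρ := by simp [Matrix.submatrix_smul]

variable [DecidableEq 𝒦] [DecidableEq ℳ]

/-- `ε`-correctness: on average over the keys, every message is accepted and correctly recovered
with probability at least `1 - ε`. -/
def IsCorrect (S : AQECM 𝒦 ℳ 𝒞) (ε : ℝ) : Prop :=
  ∀ m : ℳ, 1 - ε ≤
    ∑ k, S.keyProb k * (S.decAccept k (S.encKey k (basisState m)) m m).re

/-- The operator `((Tr_ℳ ∘ D̄_k) ⊗ Id_A) ∘ A ∘ E_k (L)` on the adversary's register. -/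
def attackOutput (S : AQECM 𝒦 ℳ 𝒞) {A : Type*}
    (attack : Op 𝒞 →ₗ[ℂ] Op (𝒞 × A)) (k : 𝒦) (L : Op ℳ) : Op A :=
  traceFirst (tensorId (S.decAccept k) A (attack (S.encKey k L)))

/-- `δ`-tamper evidence: for every tamper attack, i.e. every channel from the ciphertext space to
the ciphertext space tensored with an adversary's register. -/
def IsTamperEvident (S : AQECM 𝒦 ℳ 𝒞) (δ : ℝ) : Prop :=
  ∀ (m m' : ℳ) (A : Type) [Fintype A] [DecidableEq A] (attack : Op 𝒞 →ₗ[ℂ] Op (𝒞 × A)),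
    IsChannel attack →
    1 - δ ≤ S.probKey fun k =>
      1 / 2 * traceNorm (S.attackOutput attack k (basisState m - basisState m')) ≤ δ

/-- `δ`-encryption: averaged over the keys, the encodings of any two messages are within `δ` in
trace distance. -/
def IsEncrypting [DecidableEq 𝒞] (S : AQECM 𝒦 ℳ 𝒞) (δ : ℝ) : Prop :=
  ∀ m₀ m₁ : ℳ,
    1 / 2 * traceNorm
      (∑ k, (S.keyProb k : ℂ) • S.encKey k (basisState m₀ - basisState m₁)) ≤ δ

end AQECM

end TamperEvidence

end

/-!
The trace norm of the averaged, traceless Hermitian difference `𝔼 E_k(m₀ - m₁)` is attained by a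
projection `P`, so it suffices to bound `𝔼 Tr (P Δ_k)`, where `Δ_k = E_k(m₀ - m₁)`. Splitting the
decoder's trace by its flag writes `Tr (P Δ_k)` as an accepting part plus a rejecting part.

The accepting part is a sum of entries of the operator that remains with an adversary who
measures `{P, 1 - P}` coherently, keeps the outcome qubit and passes the ciphertext on. Tamper
evidence makes that operator small for most keys, hence also its off-diagonal entries. The rejecting
part is small because `ρ ↦ Pr[D_k rejects ρ]` is a positive functional: by Cauchy–Schwarz its value
at `P ρ` is at most the square root of its value at `ρ`, and honest ciphertexts are rarely rejected.
Altogether the scheme is `(5δ + 2√ε)`-encrypting, and trivially `1`-encrypting.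
-/

noncomputable section

namespace TamperEvidence

open Matrix

lemma exists_isStarProjection_mul_eq_posPart {A : Type*} [TopologicalSpace A] [Ring A]
    [StarRing A] [Algebra ℝ A] [IsTopologicalRing A] [T2Space A]
    [ContinuousFunctionalCalculus ℝ A IsSelfAdjoint] {a : A} (ha : IsSelfAdjoint a)
    (hfin : (spectrum ℝ a).Finite) : ∃ p, IsStarProjection p ∧ p * a = a⁺ := by
  have hcont (f : ℝ → ℝ) : ContinuousOn f (spectrum ℝ a) := hfin.continuousOn f
  let χ : ℝ → ℝ := (Set.Ici 0).indicator 1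
  have hχχ : χ * χ = χ := by
    ext x
    by_cases hx : 0 ≤ x <;> simp [χ, hx]
  have hχ (x : ℝ) : χ x * x = x⁺ := by
    rcases le_or_gt 0 x with hx | hx
    · simp [χ, hx]
    · simp [χ, hx.not_ge, hx.le]
  refine ⟨cfc χ a, ⟨?_, cfc_predicate χ a⟩, ?_⟩
  · rw [IsIdempotentElem, ← cfc_mul χ χ a (hcont _) (hcont _)]
    exact congrArg (cfc · a) hχχ
  · calc cfc χ a * a = cfc χ a * cfc id a := by rw [cfc_id ℝ a]
      _ = cfc (fun x => χ x * x) a := (cfc_mul χ id a (hcont _) (hcont _)).symm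
      _ = a⁺ := by rw [funext hχ, CFC.posPart_def, cfcₙ_eq_cfc]

section TraceNorm

variable {𝕜 n : Type*} [RCLike 𝕜]

lemma sq_norm_apply_le_of_posSemidef {B : Matrix n n 𝕜} (hB : B.PosSemidef) (i j : n) :
    ‖B i j‖ ^ 2 ≤ RCLike.re (B i i) * RCLike.re (B j j) := by
  have hminor := (hB.submatrix ![i, j]).det_nonneg
  have hji : B j i = star (B i j) := (hB.isHermitian.apply j i).symm
  have hii := hB.isHermitian.coe_re_apply_self i
  have hjj := hB.isHermitian.coe_re_apply_self j
  simp only [det_fin_two, submatrix_apply, cons_val_zero, cons_val_one, hji,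
    RCLike.star_def, RCLike.mul_conj] at hminor
  rw [← hii, ← hjj] at hminor
  exact_mod_cast sub_nonneg.1 hminor

variable [Fintype n]

lemma trace_conjTranspose_mul_self_eq_sum_sq_norm (A : Matrix n n 𝕜) :
    (Aᴴ * A).trace = ((∑ j, ∑ i, ‖A i j‖ ^ 2 : ℝ) : 𝕜) := by
  simp [trace, mul_apply, RCLike.conj_mul]

lemma re_trace_conjTranspose_mul_self_le_of_posSemidef {B : Matrix n n 𝕜} (hB : B.PosSemidef) :
    RCLike.re (Bᴴ * B).trace ≤ RCLike.re B.trace ^ 2 := by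
  rw [trace_conjTranspose_mul_self_eq_sum_sq_norm, RCLike.ofReal_re]
  calc ∑ j, ∑ i, ‖B i j‖ ^ 2
      ≤ ∑ j, ∑ i, RCLike.re (B i i) * RCLike.re (B j j) := by
        gcongr; exact sq_norm_apply_le_of_posSemidef hB _ _
    _ = RCLike.re B.trace ^ 2 := by
        simp only [trace, diag_apply, map_sum, sq, ← Finset.sum_mul, ← Finset.mul_sum]

variable [DecidableEq n]

lemma traceNorm_eq_re_trace_abs (A : Op n) : traceNorm A = (CFC.abs A).trace.re := rfl

lemma norm_apply_le_traceNorm (A : Op n) (i j : n) : ‖A i j‖ ≤ traceNorm A := by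
  have habs : (CFC.abs A).PosSemidef := (CFC.abs_nonneg A).posSemidef
  rw [traceNorm_eq_re_trace_abs]
  refine le_of_sq_le_sq ?_ (Complex.nonneg_iff.1 habs.trace_nonneg).1
  calc ‖A i j‖ ^ 2
      ≤ ∑ j, ∑ i, ‖A i j‖ ^ 2 :=
        (Finset.single_le_sum (f := fun i => ‖A i j‖ ^ 2) (fun _ _ => sq_nonneg _)
          (Finset.mem_univ i)).trans
        (Finset.single_le_sum (f := fun j => ∑ i, ‖A i j‖ ^ 2)
          (fun _ _ => Finset.sum_nonneg fun _ _ => sq_nonneg _) (Finset.mem_univ j))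
    _ = (Aᴴ * A).trace.re := by
        rw [trace_conjTranspose_mul_self_eq_sum_sq_norm]; rfl
    _ = ((CFC.abs A)ᴴ * CFC.abs A).trace.re := by
        rw [habs.isHermitian.eq, CFC.abs_mul_abs, star_eq_conjTranspose]
    _ ≤ (CFC.abs A).trace.re ^ 2 := re_trace_conjTranspose_mul_self_le_of_posSemidef habs

lemma exists_isStarProjection_two_mul_re_trace_mul {L : Op n} (hL : IsSelfAdjoint L) :
    ∃ P, IsStarProjection P ∧ 2 * (P * L).trace.re = traceNorm L + L.trace.re := by
  obtain ⟨P, hP, hPL⟩ := exists_isStarProjection_mul_eq_posPart hL finite_real_spectrum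
  refine ⟨P, hP, ?_⟩
  rw [hPL, traceNorm_eq_re_trace_abs, ← Complex.add_re, ← trace_add, CFC.abs_add_self L,
    two_nsmul, trace_add, Complex.add_re, two_mul]

end TraceNorm

section PositiveFunctional

lemma sq_norm_map_mul_mul_star_le {A : Type*} [Ring A] [StarRing A] [Algebra ℂ A]
    [StarModule ℂ A] [PartialOrder A] [StarOrderedRing A] [SelfAdjointDecompose A]
    (f : A →ₚ[ℂ] ℂ) {ρ : A} (hρ : 0 ≤ ρ) (a b : A) :
    ‖f (a * ρ * star b)‖ ^ 2 ≤ (f (a * ρ * star a)).re * (f (b * ρ * star b)).re := by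
  have hsymm (a b : A) : star (f (a * ρ * star b)) = f (b * ρ * star a) := by
    rw [← map_star f]
    simp [mul_assoc, (IsSelfAdjoint.of_nonneg hρ).star_eq]
  let form : PreInnerProductSpace.Core ℂ A :=
    { inner a b := f (b * ρ * star a)
      conj_inner_symm a b := hsymm a b
      re_inner_nonneg a :=
        (Complex.nonneg_iff.1 (f.map_nonneg (star_right_conjugate_nonneg hρ a))).1
      add_left a b c := by simp [mul_add]
      smul_left a b c := by simp }
  have hCS : ‖f (a * ρ * star b)‖ * ‖f (b * ρ * star a)‖
      ≤ (f (b * ρ * star b)).re * (f (a * ρ * star a)).re :=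
    InnerProductSpace.Core.inner_mul_inner_self_le (c := form) b a
  rwa [← hsymm a b, norm_star, ← sq, mul_comm (Complex.re _)] at hCS

variable {X : Type*} [Fintype X]

lemma trace_projection_mul_mul_projection {P : Op X} (hP : IsStarProjection P) (ρ : Op X) :
    (P * ρ * P).trace = (P * ρ).trace := by
  rw [trace_mul_comm, ← mul_assoc, hP.isIdempotentElem.eq]

lemma trace_projection_mul_nonneg {P ρ : Op X} (hP : IsStarProjection P) (hρ : 0 ≤ ρ) :
    0 ≤ (P * ρ).trace := by
  rw [← trace_projection_mul_mul_projection hP]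
  exact (hP.isSelfAdjoint.conjugate_nonneg hρ).posSemidef.trace_nonneg

lemma trace_projection_mul_le {P ρ : Op X} (hP : IsStarProjection P) (hρ : 0 ≤ ρ) :
    (P * ρ).trace ≤ ρ.trace := by
  classical
  have h := trace_projection_mul_nonneg hP.one_sub hρ
  rwa [sub_mul, one_mul, trace_sub, sub_nonneg] at h

lemma norm_map_projection_mul_le_of_le_trace {f : Op X →ₚ[ℂ] ℂ}
    (hf : ∀ σ, 0 ≤ σ → f σ ≤ σ.trace) {P ρ : Op X} (hP : IsStarProjection P) (hρ : 0 ≤ ρ) :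
    ‖f (P * ρ)‖ ≤ √(ρ.trace.re * (f ρ).re) := by
  classical
  have hfρ : 0 ≤ (f ρ).re := (Complex.nonneg_iff.1 (f.map_nonneg hρ)).1
  have hPρP : (f (P * ρ * P)).re ≤ ρ.trace.re := by
    have h := (hf _ (hP.isSelfAdjoint.conjugate_nonneg hρ)).trans
      ((trace_projection_mul_mul_projection hP ρ).trans_le (trace_projection_mul_le hP hρ))
    exact (Complex.le_def.1 h).1
  have hCS := sq_norm_map_mul_mul_star_le f hρ P 1
  simp only [star_one, mul_one, one_mul, hP.isSelfAdjoint.star_eq] at hCS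
  exact Real.le_sqrt_of_sq_le (hCS.trans (by gcongr))

end PositiveFunctional

section Channel

variable {X Y Z : Type*} [Fintype X]

lemma posSemidef_basisState [DecidableEq Z] (x : Z) : (basisState x).PosSemidef := by
  rw [basisState, ← diagonal_single]
  exact .diagonal (Pi.single_nonneg.2 zero_le_one)

lemma trace_basisState [DecidableEq X] (x : X) : (basisState x).trace = 1 :=
  trace_single_eq_same x 1

/-- Conjugation `M ↦ V M V†` by the operator `V`, as a linear map. -/
def conjBy (V : Matrix Y X ℂ) : Op X →ₗ[ℂ] Op Y :=
  mulRightLinearMap Y ℂ Vᴴ ∘ₗ mulLeftLinearMap X ℂ V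

lemma conjBy_apply (V : Matrix Y X ℂ) (M : Op X) : conjBy V M = V * M * Vᴴ := rfl

lemma tensorId_conjBy [Fintype Z] [DecidableEq Z] (V : Matrix Y X ℂ) :
    tensorId (conjBy V) Z = conjBy (V ⊗ₖ (1 : Op Z)) := by
  ext1 M
  ext ⟨y, z⟩ ⟨y', z'⟩
  simp [tensorId, conjBy_apply, mul_apply, Fintype.sum_prod_type, one_apply,
    kroneckerMap_apply, apply_ite (starRingEnd ℂ)]

variable [Fintype Y]

lemma IsChannel.posSemidef {Φ : Op X →ₗ[ℂ] Op Y} (hΦ : IsChannel Φ) {M : Op X}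
    (hM : M.PosSemidef) : (Φ M).PosSemidef :=
  (hΦ.completely_positive Unit (M.submatrix Prod.fst Prod.fst) (hM.submatrix _)).submatrix
    fun y => (y, ())

lemma isChannel_conjBy [DecidableEq X] {V : Matrix Y X ℂ} (hV : Vᴴ * V = 1) :
    IsChannel (conjBy V) where
  completely_positive Z _ M hM := by
    classical
    rw [tensorId_conjBy]
    exact hM.mul_mul_conjTranspose_same _
  trace_preserving L := by
    rw [conjBy_apply, trace_mul_comm, ← Matrix.mul_assoc, hV, Matrix.one_mul]

variable {K : Type*} [Fintype K] [DecidableEq K]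

lemma IsChannel.posSemidef_kronecker_basisState {Φ : Op (K × X) →ₗ[ℂ] Op Y} (hΦ : IsChannel Φ)
    (k : K) {ρ : Op X} (hρ : ρ.PosSemidef) : (Φ (basisState k ⊗ₖ ρ)).PosSemidef :=
  hΦ.posSemidef ((posSemidef_basisState k).kronecker hρ)

lemma IsChannel.trace_kronecker_basisState {Φ : Op (K × X) →ₗ[ℂ] Op Y} (hΦ : IsChannel Φ)
    (k : K) (ρ : Op X) : (Φ (basisState k ⊗ₖ ρ)).trace = ρ.trace := by
  rw [hΦ.trace_preserving, trace_kronecker, trace_basisState, one_mul]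

end Channel

section CoherentMeasurement

variable {X Y ι : Type*}

/-- The Stinespring operator `|x⟩ ↦ ∑ i, F i |x⟩ ⊗ |i⟩` of a family `F` of Kraus operators. -/
def stinespring (F : ι → Matrix Y X ℂ) : Matrix (Y × ι) X ℂ :=
  of fun p x => F p.2 p.1 x

lemma conjTranspose_stinespring_mul_self [Fintype Y] [Fintype ι] (F : ι → Matrix Y X ℂ) :
    (stinespring F)ᴴ * stinespring F = ∑ i, (F i)ᴴ * F i := by
  ext x x'
  simp [stinespring, mul_apply, Matrix.sum_apply, Fintype.sum_prod_type_right]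

/-- The two-outcome measurement `{P, 1 - P}`, with outcome `true` standing for `P`. -/
def binaryMeasurement [DecidableEq X] (P : Op X) (b : Bool) : Op X := if b then P else 1 - P

lemma sum_binaryMeasurement [DecidableEq X] (P : Op X) : ∑ b, binaryMeasurement P b = 1 := by
  simp [binaryMeasurement]

variable [Fintype X]

/-- The measurement with Kraus operators `F`, performed coherently: the outcome is written to the
second register without being dephased. -/
def coherentMeasurement (F : ι → Matrix Y X ℂ) : Op X →ₗ[ℂ] Op (Y × ι) :=
  conjBy (stinespring F)

lemma coherentMeasurement_submatrix (F : ι → Matrix Y X ℂ) (M : Op X) (i j : ι) :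
    (coherentMeasurement F M).submatrix (fun y => (y, i)) (fun y => (y, j)) = F i * M * (F j)ᴴ :=
  rfl

lemma isChannel_coherentMeasurement [Fintype Y] [Fintype ι] [DecidableEq X]
    {F : ι → Matrix Y X ℂ} (hF : ∑ i, (F i)ᴴ * F i = 1) : IsChannel (coherentMeasurement F) :=
  isChannel_conjBy ((conjTranspose_stinespring_mul_self F).trans hF)

lemma isChannel_coherentMeasurement_binaryMeasurement [DecidableEq X] {P : Op X}
    (hP : IsStarProjection P) : IsChannel (coherentMeasurement (binaryMeasurement P)) := by
  refine isChannel_coherentMeasurement ?_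
  have hQ := hP.one_sub
  rw [← sum_binaryMeasurement P, Fintype.sum_bool, Fintype.sum_bool]
  congr 1
  · exact (congrArg (· * P) hP.isSelfAdjoint).trans hP.isIdempotentElem
  · exact (congrArg (· * (1 - P)) hQ.isSelfAdjoint).trans hQ.isIdempotentElem

end CoherentMeasurement

namespace AQECM

variable {𝒦 ℳ 𝒞 : Type*} [Fintype 𝒦] [Fintype ℳ] [Fintype 𝒞]

section KeyAverages

variable (S : AQECM 𝒦 ℳ 𝒞)

lemma keyProb_nonneg (k : 𝒦) : 0 ≤ S.keyProb k :=
  (Complex.nonneg_iff.1 (S.keyGen_channel.posSemidef .one).diag_nonneg).1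

lemma sum_keyProb : ∑ k, S.keyProb k = 1 := by
  simpa [trace, keyProb] using congrArg Complex.re (S.keyGen_channel.trace_preserving 1)

lemma probKey_le_one (P : 𝒦 → Prop) : S.probKey P ≤ 1 := by
  rw [← S.sum_keyProb]
  exact Finset.sum_le_sum fun k _ => Set.indicator_le_self' (fun k _ => S.keyProb_nonneg k) k

lemma sum_keyProb_mul_le_of_forall_le {f : 𝒦 → ℝ} {c : ℝ} (hf : ∀ k, f k ≤ c) :
    ∑ k, S.keyProb k * f k ≤ c := by
  calc ∑ k, S.keyProb k * f k ≤ ∑ k, S.keyProb k * c := by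
        gcongr with k
        exacts [S.keyProb_nonneg k, hf k]
    _ = c := by rw [← Finset.sum_mul, S.sum_keyProb, one_mul]

lemma sum_keyProb_mul_sqrt_le {f : 𝒦 → ℝ} (hf : ∀ k, 0 ≤ f k) :
    ∑ k, S.keyProb k * √(f k) ≤ √(∑ k, S.keyProb k * f k) :=
  Real.strictConcaveOn_sqrt.concaveOn.le_map_sum (fun k _ => S.keyProb_nonneg k)
    S.sum_keyProb fun k _ => hf k

lemma sum_keyProb_mul_le_of_le_probKey {P : 𝒦 → Prop} {f g : 𝒦 → ℝ} {c δ : ℝ}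
    (hP : 1 - δ ≤ S.probKey P) (hc : 0 ≤ c) (hg : ∀ k, 0 ≤ g k) (hf : ∀ k, f k ≤ 1)
    (hfg : ∀ k, P k → f k ≤ c + g k) :
    ∑ k, S.keyProb k * f k ≤ c + δ + ∑ k, S.keyProb k * g k := by
  have hkey (k : 𝒦) : S.keyProb k * f k
      ≤ S.keyProb k * (c + 1) - {k | P k}.indicator S.keyProb k + S.keyProb k * g k := by
    have hp := S.keyProb_nonneg k
    by_cases hk : P k
    · rw [Set.indicator_of_mem (s := {k | P k}) hk]
      linarith [mul_le_mul_of_nonneg_left (hfg k hk) hp]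
    · rw [Set.indicator_of_notMem (s := {k | P k}) hk]
      linarith [mul_le_mul_of_nonneg_left (hf k) hp, mul_nonneg hp hc, mul_nonneg hp (hg k)]
  have hsum := Finset.sum_le_sum fun k (_ : k ∈ Finset.univ) => hkey k
  rw [Finset.sum_add_distrib, Finset.sum_sub_distrib, ← Finset.sum_mul, S.sum_keyProb] at hsum
  rw [probKey] at hP
  linarith

end KeyAverages

section Decoding

variable [DecidableEq 𝒦] (S : AQECM 𝒦 ℳ 𝒞) (k : 𝒦)

lemma posSemidef_encKey {ρ : Op ℳ} (hρ : ρ.PosSemidef) : (S.encKey k ρ).PosSemidef :=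
  S.enc_channel.posSemidef_kronecker_basisState k hρ

lemma trace_encKey (ρ : Op ℳ) : (S.encKey k ρ).trace = ρ.trace :=
  S.enc_channel.trace_kronecker_basisState k ρ

lemma posSemidef_decKey {ρ : Op 𝒞} (hρ : ρ.PosSemidef) : (S.decKey k ρ).PosSemidef :=
  S.dec_channel.posSemidef_kronecker_basisState k hρ

lemma trace_decKey (ρ : Op 𝒞) : (S.decKey k ρ).trace = ρ.trace :=
  S.dec_channel.trace_kronecker_basisState k ρ

/-- The probability that the decoder with key `k` raises the flag `b`, as a positive linear
functional of the ciphertext. -/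
def flagProb (b : Bool) : Op 𝒞 →ₚ[ℂ] ℂ :=
  .mk₀
    { toFun ρ := ∑ m, S.decKey k ρ (m, b) (m, b)
      map_add' ρ σ := by simp [Finset.sum_add_distrib]
      map_smul' c ρ := by simp [Finset.mul_sum] }
    fun _ hρ => Finset.sum_nonneg fun _ _ => (S.posSemidef_decKey k hρ.posSemidef).diag_nonneg

lemma flagProb_true_add_flagProb_false (ρ : Op 𝒞) :
    S.flagProb k true ρ + S.flagProb k false ρ = ρ.trace := by
  rw [← S.trace_decKey k ρ, trace, Fintype.sum_prod_type_right, Fintype.sum_bool]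
  rfl

lemma flagProb_le_trace (b : Bool) {σ : Op 𝒞} (hσ : 0 ≤ σ) : S.flagProb k b σ ≤ σ.trace := by
  rw [← S.flagProb_true_add_flagProb_false k σ]
  cases b
  · exact le_add_of_nonneg_left ((S.flagProb k true).map_nonneg hσ)
  · exact le_add_of_nonneg_right ((S.flagProb k false).map_nonneg hσ)

lemma re_decAccept_apply_le {ρ : Op 𝒞} (hρ : 0 ≤ ρ) (m : ℳ) :
    (S.decAccept k ρ m m).re ≤ (S.flagProb k true ρ).re :=
  (Complex.le_def.1 (Finset.single_le_sum (f := fun m => S.decKey k ρ (m, true) (m, true))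
    (fun _ _ => (S.posSemidef_decKey k hρ.posSemidef).diag_nonneg) (Finset.mem_univ m))).1

lemma attackOutput_coherentMeasurement {ι : Type*} (F : ι → Op 𝒞) (L : Op ℳ) (i j : ι) :
    S.attackOutput (coherentMeasurement F) k L i j
      = S.flagProb k true (F i * S.encKey k L * (F j)ᴴ) :=
  congrArg (S.flagProb k true) (coherentMeasurement_submatrix F _ i j)

lemma norm_flagProb_true_mul_encKey_le [DecidableEq 𝒞] (P : Op 𝒞) (L : Op ℳ) :
    ‖S.flagProb k true (P * S.encKey k L)‖
      ≤ 2 * traceNorm (S.attackOutput (coherentMeasurement (binaryMeasurement P)) k L) := by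
  set F := binaryMeasurement P
  set A := S.attackOutput (coherentMeasurement F) k L with hA
  have hF : ∑ b, (F b)ᴴ = 1 := by
    rw [← conjTranspose_sum, sum_binaryMeasurement, conjTranspose_one]
  -- The two outcomes recombine to `∑ b, F b = 1`, which turns `P * ρ * (F b)ᴴ` back into `P * ρ`.
  have hrow : S.flagProb k true (P * S.encKey k L) = ∑ b, A true b := by
    simp only [hA, attackOutput_coherentMeasurement, ← map_sum, ← Finset.mul_sum, hF, mul_one]
    rfl
  rw [hrow, Fintype.sum_bool, two_mul]
  exact (norm_add_le _ _).trans
    (add_le_add (norm_apply_le_traceNorm _ _ _) (norm_apply_le_traceNorm _ _ _))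

end Decoding

variable [DecidableEq 𝒦] [DecidableEq ℳ] {S : AQECM 𝒦 ℳ 𝒞} {ε δ : ℝ}

/-- Every honest ciphertext is accepted with probability at least `1 - ε` on average over the keys;
unlike in `IsCorrect`, the message need not be recovered. -/
def IsAccepting (S : AQECM 𝒦 ℳ 𝒞) (ε : ℝ) : Prop :=
  ∀ m : ℳ, 1 - ε ≤ ∑ k, S.keyProb k * (S.flagProb k true (S.encKey k (basisState m))).re

/-- Tamper evidence against adversaries that keep a single qubit. -/
def IsQubitTamperEvident (S : AQECM 𝒦 ℳ 𝒞) (δ : ℝ) : Prop :=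
  ∀ (m m' : ℳ) (attack : Op 𝒞 →ₗ[ℂ] Op (𝒞 × Bool)), IsChannel attack →
    1 - δ ≤ S.probKey fun k =>
      1 / 2 * traceNorm (S.attackOutput attack k (basisState m - basisState m')) ≤ δ

lemma encKey_basisState_nonneg (S : AQECM 𝒦 ℳ 𝒞) (k : 𝒦) (m : ℳ) :
    0 ≤ S.encKey k (basisState m) :=
  (S.posSemidef_encKey k (posSemidef_basisState m)).nonneg

lemma trace_encKey_basisState (S : AQECM 𝒦 ℳ 𝒞) (k : 𝒦) (m : ℳ) :
    (S.encKey k (basisState m)).trace = 1 := by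
  rw [trace_encKey, trace_basisState]

lemma IsCorrect.isAccepting (hS : S.IsCorrect ε) : S.IsAccepting ε := fun m =>
  (hS m).trans <| Finset.sum_le_sum fun k _ => mul_le_mul_of_nonneg_left
    (S.re_decAccept_apply_le k (S.encKey_basisState_nonneg k m) m) (S.keyProb_nonneg k)

lemma IsTamperEvident.isQubitTamperEvident (hS : S.IsTamperEvident δ) :
    S.IsQubitTamperEvident δ := fun m m' => hS m m' Bool

lemma IsQubitTamperEvident.nonneg (hS : S.IsQubitTamperEvident δ) (m : ℳ) : 0 ≤ δ := by
  classical
  have h := hS m m _ (isChannel_coherentMeasurement_binaryMeasurement (.one _))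
  linarith [h.trans (S.probKey_le_one _)]

lemma IsEncrypting.mono [DecidableEq 𝒞] {δ' : ℝ} (hS : S.IsEncrypting δ) (h : δ ≤ δ') :
    S.IsEncrypting δ' := fun m₀ m₁ => (hS m₀ m₁).trans h

/-- The probability that the decoder with key `k` rejects the honest encryption of `m`. -/
def rejectProb (S : AQECM 𝒦 ℳ 𝒞) (m : ℳ) (k : 𝒦) : ℝ :=
  (S.flagProb k false (S.encKey k (basisState m))).re

lemma rejectProb_nonneg (m : ℳ) (k : 𝒦) : 0 ≤ S.rejectProb m k :=
  (Complex.nonneg_iff.1 ((S.flagProb k false).map_nonneg (S.encKey_basisState_nonneg k m))).1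

lemma IsAccepting.sum_keyProb_mul_rejectProb_le (hS : S.IsAccepting ε) (m : ℳ) :
    ∑ k, S.keyProb k * S.rejectProb m k ≤ ε := by
  have hreject (k : 𝒦) : S.rejectProb m k
      = 1 - (S.flagProb k true (S.encKey k (basisState m))).re := by
    rw [eq_sub_iff_add_eq', rejectProb, ← Complex.add_re, flagProb_true_add_flagProb_false,
      trace_encKey_basisState, Complex.one_re]
  simp only [hreject, mul_sub, mul_one, Finset.sum_sub_distrib, S.sum_keyProb]
  linarith [hS m]

lemma IsAccepting.sum_keyProb_mul_sqrt_rejectProb_le (hS : S.IsAccepting ε) (m : ℳ) :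
    ∑ k, S.keyProb k * √(S.rejectProb m k) ≤ √ε :=
  (S.sum_keyProb_mul_sqrt_le (rejectProb_nonneg m)).trans
    (Real.sqrt_le_sqrt (hS.sum_keyProb_mul_rejectProb_le m))

/-- The advantage of the test `P` in telling apart the encryptions of `m` and `m'` under the
key `k`. -/
def testAdvantage (S : AQECM 𝒦 ℳ 𝒞) (P : Op 𝒞) (m m' : ℳ) (k : 𝒦) : ℝ :=
  (P * S.encKey k (basisState m - basisState m')).trace.re

lemma testAdvantage_le_one {P : Op 𝒞} (hP : IsStarProjection P) (m m' : ℳ) (k : 𝒦) :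
    S.testAdvantage P m m' k ≤ 1 := by
  have hm := (Complex.le_def.1 (trace_projection_mul_le hP (S.encKey_basisState_nonneg k m))).1
  have hm' := (Complex.le_def.1
    (trace_projection_mul_nonneg hP (S.encKey_basisState_nonneg k m'))).1
  rw [trace_encKey_basisState] at hm
  rw [testAdvantage, map_sub, mul_sub, trace_sub, Complex.sub_re]
  exact (sub_le_self _ hm').trans hm

lemma norm_flagProb_false_projection_mul_encKey_le {P : Op 𝒞} (hP : IsStarProjection P) (m : ℳ)
    (k : 𝒦) :
    ‖S.flagProb k false (P * S.encKey k (basisState m))‖ ≤ √(S.rejectProb m k) := by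
  have h := norm_map_projection_mul_le_of_le_trace (fun _ => S.flagProb_le_trace k false) hP
    (S.encKey_basisState_nonneg k m)
  rwa [trace_encKey_basisState, Complex.one_re, one_mul] at h

lemma testAdvantage_le [DecidableEq 𝒞] {P : Op 𝒞} (hP : IsStarProjection P) (m m' : ℳ) (k : 𝒦) :
    S.testAdvantage P m m' k
      ≤ 2 * traceNorm (S.attackOutput (coherentMeasurement (binaryMeasurement P)) k
            (basisState m - basisState m'))
        + (√(S.rejectProb m k) + √(S.rejectProb m' k)) := by
  rw [testAdvantage, ← S.flagProb_true_add_flagProb_false k, Complex.add_re]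
  refine add_le_add ((Complex.re_le_norm _).trans (S.norm_flagProb_true_mul_encKey_le k P _))
    ((Complex.re_le_norm _).trans ?_)
  rw [map_sub, mul_sub, map_sub]
  exact (norm_sub_le _ _).trans (add_le_add
    (norm_flagProb_false_projection_mul_encKey_le hP m k)
    (norm_flagProb_false_projection_mul_encKey_le hP m' k))

lemma isEncrypting_of_forall_isStarProjection [DecidableEq 𝒞]
    (h : ∀ m₀ m₁ P, IsStarProjection P → ∑ k, S.keyProb k * S.testAdvantage P m₀ m₁ k ≤ δ) :
    S.IsEncrypting δ := by
  intro m₀ m₁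
  set L := ∑ k, (S.keyProb k : ℂ) • S.encKey k (basisState m₀ - basisState m₁) with hL
  have hL_self : IsSelfAdjoint L := by
    refine isSelfAdjoint_sum _ fun k _ => .smul (Complex.conj_ofReal _) ?_
    rw [map_sub]
    exact (IsSelfAdjoint.of_nonneg (S.encKey_basisState_nonneg k m₀)).sub
      (.of_nonneg (S.encKey_basisState_nonneg k m₁))
  have hL_trace : L.trace = 0 := by
    simp [hL, trace_sum, trace_encKey, trace_sub, trace_basisState]
  obtain ⟨P, hP, hPL⟩ := exists_isStarProjection_two_mul_re_trace_mul hL_self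
  have hadv : (P * L).trace.re = ∑ k, S.keyProb k * S.testAdvantage P m₀ m₁ k := by
    simp [hL, Finset.mul_sum, trace_sum, testAdvantage]
  rw [hL_trace, Complex.zero_re, add_zero, hadv] at hPL
  linarith [h m₀ m₁ P hP]

lemma sum_keyProb_mul_testAdvantage_le (hε : S.IsAccepting ε)
    (hδ : S.IsQubitTamperEvident δ) {P : Op 𝒞} (hP : IsStarProjection P) (m₀ m₁ : ℳ) :
    ∑ k, S.keyProb k * S.testAdvantage P m₀ m₁ k ≤ 5 * δ + 2 * √ε := by
  classical
  have hgood := hδ m₀ m₁ _ (isChannel_coherentMeasurement_binaryMeasurement hP)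
  have havg := S.sum_keyProb_mul_le_of_le_probKey (c := 4 * δ) hgood
    (mul_nonneg zero_le_four (hδ.nonneg m₀))
    (fun k => add_nonneg (Real.sqrt_nonneg (S.rejectProb m₀ k))
      (Real.sqrt_nonneg (S.rejectProb m₁ k)))
    (testAdvantage_le_one hP m₀ m₁)
    (fun k hk => (testAdvantage_le hP m₀ m₁ k).trans (by linarith))
  simp only [mul_add, Finset.sum_add_distrib] at havg
  linarith [hε.sum_keyProb_mul_sqrt_rejectProb_le m₀, hε.sum_keyProb_mul_sqrt_rejectProb_le m₁]

end AQECM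

lemma min_one_five_mul_add_le_sqrt (ε δ : ℝ) : min 1 (5 * δ + 2 * √ε) ≤ √(19 * (δ + √(2 * ε))) := by
  have hsqrt : 2 * √ε ≤ 5 * √(2 * ε) := by
    rcases le_total 0 ε with hε | hε
    · linarith [Real.sqrt_le_sqrt (show ε ≤ 2 * ε by linarith), Real.sqrt_nonneg ε]
    · rw [Real.sqrt_eq_zero_of_nonpos hε, mul_zero]
      positivity
  set t := δ + √(2 * ε)
  set a := min 1 (5 * δ + 2 * √ε)
  have ha₁ : a ≤ 1 := min_le_left _ _
  have hat : a ≤ 5 * t := (min_le_right _ _).trans (by simp only [t]; linarith)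
  rcases le_total a 0 with ha | ha
  · exact ha.trans (Real.sqrt_nonneg _)
  · refine Real.le_sqrt_of_sq_le ?_
    nlinarith

end TamperEvidence

end

open TamperEvidence AQECM in
theorem mainTheorem1_general {𝒦 ℳ 𝒞 : Type*} [Fintype 𝒦] [Fintype ℳ] [Fintype 𝒞]
    [DecidableEq 𝒦] [DecidableEq ℳ] [DecidableEq 𝒞] {S : AQECM 𝒦 ℳ 𝒞} {ε δ : ℝ}
    (haccept : S.IsAccepting ε) (htamper : S.IsQubitTamperEvident δ) :
    S.IsEncrypting (min 1 (5 * δ + 2 * √ε)) :=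
  isEncrypting_of_forall_isStarProjection fun m₀ m₁ _ hP =>
    le_min (S.sum_keyProb_mul_le_of_forall_le (testAdvantage_le_one hP m₀ m₁))
      (sum_keyProb_mul_testAdvantage_le haccept htamper hP m₀ m₁)

theorem mainTheorem1 {𝒦 ℳ 𝒞 : Type*} [Fintype 𝒦] [Fintype ℳ] [Fintype 𝒞]
    [DecidableEq 𝒦] [DecidableEq ℳ] [DecidableEq 𝒞]
    (S : TamperEvidence.AQECM 𝒦 ℳ 𝒞) (ε δ : ℝ)
    (hcorrect : S.IsCorrect ε) (htamper : S.IsTamperEvident δ) :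
    S.IsEncrypting (Real.sqrt (19 * (δ + Real.sqrt (2 * ε)))) :=
  (mainTheorem1_general hcorrect.isAccepting htamper.isQubitTamperEvident).mono
    (TamperEvidence.min_one_five_mul_add_le_sqrt ε δ)
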